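/- Let $d\ge 1$, $\alpha\in(0,2)$, and let $\nu$ be a symmetric Lévy measure on $\mathbb{R}^d$, i.e. a Borel measure with $\nu(\{0\})=0$, $\int \min(1,|y|^2)\,\nu(dy)<\infty$ and $\nu(-D)=\nu(D)$ for all Borel sets $D$. Put $\Phi(\xi)=\int_{\mathbb{R}^d}(1-\cos\langle\xi,y\rangle)\,\nu(dy)$ and let $(P_t)_{t\ge 0}$ be the convolution semigroup of probability measures on $\mathbb{R}^d$ with Fourier transforms $\mathcal{F}(P_t)(\xi)=e^{-t\Phi(\xi)}$. Assume that $\Phi(\xi)\ge c|\xi|^\alpha$ for all $|\xi|>1$, for some constant $c>0$. Then for every $t>0$ the measure $P_t$ has a smooth bounded density $p_t$ with respect to Lebesgue measure. Suppose that there are a set $A\subset\mathbb{R}^d$, constants $\gamma\in[1,d]$, $c_1,c_2>0$ and a bounded function $q:(0,\infty)\to(0,\infty)$ such that $$\nu(B(x,r))\ \ge\ c_1\, r^{\gamma}\,|x|^{-\alpha-\gamma}\,q(|x|),\qquad x\in A\setminus\{0\},\ r>0,$$ $$\nu(B(0,r)^c)\ \le\ c_2\, r^{-\alpha},\qquad r\in(0,1),$$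 where $B(x,r)$ is the open ball. Then there is a constant $C>0$, which depends only on $d,\alpha,\gamma,q,c,c_1,c_2$, such that $$p_t(x)\ \ge\ C\,\min\!\left(t^{-d/\alpha},\ t^{1+\frac{\gamma-d}{\alpha}}\,|x|^{-\alpha-\gamma}\,q(|x|)\right),\qquad x\in A,\ t\in(0,1),$$ where for $x=0$ the second term of the minimum is read as $+\infty$ (so the bound is $C\,t^{-d/\alpha}$). -/

import Mathlib

open MeasureTheory
open scoped ContDiff

noncomputable section

/-- A symmetric Lévy measure on `ℝ^d`: no mass at the origin, `∫ min(1, |y|²) ν(dy) < ∞`,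
and invariance under `y ↦ -y`. -/
structure IsSymmetricLevyMeasure {d : ℕ} (ν : Measure (EuclideanSpace ℝ (Fin d))) : Prop where
  zero : ν {0} = 0
  lintegral_lt_top : ∫⁻ y, ENNReal.ofReal (min 1 (‖y‖ ^ 2)) ∂ν < ⊤
  symm : ν.map (fun y => -y) = ν

/-- The Lévy-Khinchin exponent `Φ(ξ) = ∫ (1 - cos ⟨ξ, y⟩) ν(dy)`. -/
def levyExponent {d : ℕ} (ν : Measure (EuclideanSpace ℝ (Fin d)))
    (ξ : EuclideanSpace ℝ (Fin d)) : ℝ :=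
  ∫ y, (1 - Real.cos (inner ℝ ξ y)) ∂ν

/-- `(P_t)_{t ≥ 0}` is the family of probability measures with Fourier transform
`exp (-t Φ(ξ))`. As a finite measure is determined by its Fourier transform, there is at most
one such family, and it is automatically a convolution semigroup with `P_0 = δ_0`. -/
def IsLevySemigroup {d : ℕ} (ν : Measure (EuclideanSpace ℝ (Fin d)))
    (P : ℝ → Measure (EuclideanSpace ℝ (Fin d))) : Prop :=
  ∀ t : ℝ, 0 ≤ t → IsProbabilityMeasure (P t) ∧
    ∀ ξ, charFun (P t) ξ = Complex.exp (-((t * levyExponent ν ξ : ℝ) : ℂ))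

/-- `f` is a smooth bounded density of `μ` with respect to Lebesgue measure
(by continuity, there is at most one). -/
structure IsSmoothBoundedDensity {d : ℕ} (μ : Measure (EuclideanSpace ℝ (Fin d)))
    (f : EuclideanSpace ℝ (Fin d) → ℝ) : Prop where
  smooth : ContDiff ℝ ∞ f
  nonneg : ∀ x, 0 ≤ f x
  bounded : ∃ M : ℝ, ∀ x, f x ≤ M
  eq_withDensity : μ = volume.withDensity (fun x => ENNReal.ofReal (f x))

open Classical in
/-- `min (t^{-d/α}, t^{1+(γ-d)/α} |x|^{-α-γ} q(|x|))`. At `x = 0` the second term is read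
as `+∞`, so that the minimum is `t^{-d/α}`. -/
def lowerProfile {d : ℕ} (α γ : ℝ) (q : ℝ → ℝ) (t : ℝ) (x : EuclideanSpace ℝ (Fin d)) : ℝ :=
  if x = 0 then t ^ (-(d : ℝ) / α)
  else min (t ^ (-(d : ℝ) / α)) (t ^ (1 + (γ - d) / α) * ‖x‖ ^ (-α - γ) * q ‖x‖)

end

/-! The scale of the process at time $t$ is $t^{1/\alpha}$. Put $\varepsilon=\delta t^{1/\alpha}$
and write $\nu=\nu_s+\frac12\nu_o$, where $\nu_o$ is the restriction of $\nu$ to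
$B(0,\varepsilon)^c$ and $\nu_s$ keeps all small jumps and half of the large ones. Then $P_t$ is the
law with exponent $t\Phi_{\nu_s}$ convolved with a compound Poisson law of jump measure $m=\frac
t2\nu_o$.

Two estimates suffice. Since $\Phi_{\nu_s}\ge\frac12\Phi$ and the tail bound gives
$\Phi_{\nu_s}(\xi)\lesssim|\xi|^\alpha$ for $|\xi|\ge1$, the density of the first factor is at least
$\kappa t^{-d/\alpha}$ on a ball of radius comparable to $t^{1/\alpha}$
(`exists_forall_le_expDensity`, `levyExponent_le_mul_rpow`). The compound Poisson law dominates its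
one-jump term $e^{-|m|}m$ (`le_compoundPoisson`), and the tail bound gives
$|m|\le\frac12c_2\delta^{-\alpha}$, independent of $t$. Hence, when $|x|\ge2\varepsilon$, one jump
into $B(x,\varepsilon)$ yields $p_t(x)\gtrsim t^{-d/\alpha}\cdot t\,\nu(B(x,\varepsilon))$
(`levyDensity_ge_of_jump`), which is the second term of the minimum. For $|x|<2\varepsilon$ the
near-origin estimate applies directly.

Densities are defined by Fourier inversion. Their nonnegativity and their identification with $P_t$
come from Parseval against test functions (`fourier_re_nonneg`, `eq_withDensity_of_charFun_eq`). -/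

section LevyDensities

open scoped FourierTransform SchwartzMap
open Filter Topology

/-! ### Fourier inversion for finite measures with integrable characteristic function. -/

section FourierInversion

set_option linter.unusedSectionVars false

variable {E : Type*} [NormedAddCommGroup E] [InnerProductSpace ℝ E] [FiniteDimensional ℝ E]
  [MeasurableSpace E] [BorelSpace E]

/-- Parseval's relation between a finite measure and a Schwartz function. -/
lemma integral_charFun_mul_fourier (μ : Measure E) [IsFiniteMeasure μ] (ψ : 𝓢(E, ℂ)) :
    ∫ v, charFun μ ((2 * Real.pi) • v) * 𝓕 (ψ : E → ℂ) v = ∫ x, ψ x ∂μ := by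
  have h1 : Integrable (fun _ : E => (1 : ℂ)) μ := integrable_const _
  have h2 : Integrable (𝓕 (ψ : E → ℂ)) := by
    rw [← SchwartzMap.fourier_coe]; exact (𝓕 ψ).integrable
  -- The pairing is $-\langle\cdot,\cdot\rangle$ because `charFun` carries $e^{+i\langle
  -- x,\xi\rangle}$; on the other side the same sign produces the inverse transform, which undoes `𝓕
  -- ψ`.
  have h := VectorFourier.integral_fourierIntegral_smul_eq_flip (μ := μ) (ν := volume)
    (L := -innerₗ E) Real.continuous_fourierChar (by
      show Continuous fun p : E × E => -(inner ℝ p.1 p.2)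
      fun_prop) h1 h2
  have e1 : ∀ v, VectorFourier.fourierIntegral Real.fourierChar μ (-innerₗ E) (fun _ => (1:ℂ)) v
      = charFun μ ((2 * Real.pi) • v) := by
    intro v
    rw [charFun_apply]
    simp only [VectorFourier.fourierIntegral, LinearMap.neg_apply, innerₗ_apply_apply, neg_neg,
      Circle.smul_def, Real.fourierChar_apply, smul_eq_mul, mul_one, inner_smul_right]
  have e2 : ∀ x, VectorFourier.fourierIntegral Real.fourierChar volume (-innerₗ E).flip
      (𝓕 (ψ : E → ℂ)) x = ψ x := by
    intro x
    have : (-innerₗ E).flip = -innerₗ E := by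
      ext a b; simp [real_inner_comm]
    rw [this]
    have h3 : 𝓕⁻ (𝓕 (ψ : E → ℂ)) x = ψ x := by
      rw [ψ.continuous.fourierInv_fourier_eq ψ.integrable h2]
    exact h3
  simp only [e1, e2, smul_eq_mul, one_mul] at h
  exact h

lemma integral_fourier_mul_schwartz {G : E → ℂ} (hG : Integrable G) (ψ : 𝓢(E, ℂ)) :
    ∫ x, 𝓕 G x * ψ x = ∫ v, G v * 𝓕 (ψ : E → ℂ) v := by
  have h := VectorFourier.integral_fourierIntegral_smul_eq_flip (μ := volume) (ν := volume)
    (L := innerₗ E) Real.continuous_fourierChar (by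
      show Continuous fun p : E × E => (inner ℝ p.1 p.2)
      fun_prop) hG ψ.integrable
  have e : (innerₗ E).flip = innerₗ E := by
    ext a b; simp
  rw [e] at h
  exact h

lemma continuous_fourier_of_integrable {G : E → ℂ} (hG : Integrable G) : Continuous (𝓕 G) :=
  VectorFourier.fourierIntegral_continuous Real.continuous_fourierChar
    (by show Continuous fun p : E × E => (inner ℝ p.1 p.2); fun_prop) hG

/-- The Schwartz function attached to a real smooth compactly supported function. -/
noncomputable def HasCompactSupport.toComplexSchwartz {f : E → ℝ} (hf : HasCompactSupport f)
    (hs : ContDiff ℝ ∞ f) : 𝓢(E, ℂ) :=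
  HasCompactSupport.toSchwartzMap (f := fun x => (f x : ℂ))
    (hf.comp_left (g := fun y : ℝ => (y : ℂ)) Complex.ofReal_zero)
    (Complex.ofRealCLM.contDiff.comp hs)

lemma HasCompactSupport.toComplexSchwartz_apply {f : E → ℝ} (hf : HasCompactSupport f)
    (hs : ContDiff ℝ ∞ f) (x : E) : hf.toComplexSchwartz hs x = (f x : ℂ) := rfl

/-- With `integral_eq_re_integral_charFun`, this expresses integrals of a test function against `(𝓕
G).re` and against a measure as the same kind of frequency integral, so that `G` can be compared
with `charFun`. -/
lemma integral_re_fourier_mul {G : E → ℂ} (hG : Integrable G) {f : E → ℝ}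
    (hf : HasCompactSupport f) (hs : ContDiff ℝ ∞ f) :
    ∫ x, (𝓕 G x).re * f x =
      (∫ v, G v * 𝓕 (hf.toComplexSchwartz hs : E → ℂ) v).re := by
  rw [← integral_fourier_mul_schwartz hG, ← Complex.reCLM_apply,
    ← ContinuousLinearMap.integral_comp_comm]
  · refine integral_congr_ae (ae_of_all _ fun x => ?_)
    simp [HasCompactSupport.toComplexSchwartz_apply]
  · have hc : Continuous fun x => 𝓕 G x * hf.toComplexSchwartz hs x :=
      (continuous_fourier_of_integrable hG).mul (SchwartzMap.continuous _)
    refine hc.integrable_of_hasCompactSupport (HasCompactSupport.mul_left ?_)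
    exact hf.comp_left (g := fun y : ℝ => (y : ℂ)) Complex.ofReal_zero

lemma integral_eq_re_integral_charFun (μ : Measure E) [IsFiniteMeasure μ] {f : E → ℝ}
    (hf : HasCompactSupport f) (hs : ContDiff ℝ ∞ f) :
    ∫ x, f x ∂μ = (∫ v, charFun μ ((2 * Real.pi) • v) *
      𝓕 (hf.toComplexSchwartz hs : E → ℂ) v).re := by
  rw [integral_charFun_mul_fourier]
  simp only [HasCompactSupport.toComplexSchwartz_apply]
  rw [integral_complex_ofReal, Complex.ofReal_re]

/-- The Fourier transform of an integrable limit of characteristic functions is nonnegative. -/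
lemma fourier_re_nonneg {G : E → ℂ} (hG : Integrable G) (μ : ℕ → Measure E)
    [∀ n, IsProbabilityMeasure (μ n)]
    (h : ∀ v, Tendsto (fun n => charFun (μ n) ((2 * Real.pi) • v)) atTop (𝓝 (G v))) (x : E) :
    0 ≤ (𝓕 G x).re := by
  by_contra! hx
  have hcont : Continuous fun y => (𝓕 G y).re :=
    Complex.continuous_re.comp (continuous_fourier_of_integrable hG)
  have hopen : IsOpen {y | (𝓕 G y).re < 0} := isOpen_lt hcont continuous_const
  -- A bump supported where the transform is negative gives a negative integral, although Parseval
  -- makes that integral a limit of the numbers $\int f\,d\mu_n\ge0$.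
  obtain ⟨f, hfsub, hfc, hfs, hfr, hfx⟩ :=
    exists_contDiff_tsupport_subset (n := ⊤) (hopen.mem_nhds hx)
  have hf0 : ∀ y, 0 ≤ f y := fun y => (hfr ⟨y, rfl⟩).1
  have hpos : 0 ≤ ∫ y, (𝓕 G y).re * f y := by
    rw [integral_re_fourier_mul hG hfc hfs]
    have hF : Integrable (𝓕 (hfc.toComplexSchwartz hfs : E → ℂ)) := by
      rw [← SchwartzMap.fourier_coe]; exact SchwartzMap.integrable _
    have hlim : Tendsto (fun n => ∫ v, charFun (μ n) ((2 * Real.pi) • v) *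
        𝓕 (hfc.toComplexSchwartz hfs : E → ℂ) v) atTop
        (𝓝 (∫ v, G v * 𝓕 (hfc.toComplexSchwartz hfs : E → ℂ) v)) := by
      refine tendsto_integral_of_dominated_convergence
        (fun v => ‖𝓕 (hfc.toComplexSchwartz hfs : E → ℂ) v‖) (fun n => ?_) hF.norm (fun n => ?_) ?_
      · exact (Continuous.aestronglyMeasurable (by fun_prop)).mul hF.1
      · refine ae_of_all _ fun v => ?_
        rw [norm_mul]
        exact mul_le_of_le_one_left (norm_nonneg _) (norm_charFun_le_one _)
      · exact ae_of_all _ fun v => (h v).mul_const _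
    refine ge_of_tendsto ((Complex.continuous_re.tendsto _).comp hlim) (Eventually.of_forall ?_)
    intro n
    simp only [Function.comp_apply]
    rw [← integral_eq_re_integral_charFun]
    exact integral_nonneg hf0
  have hneg : 0 < ∫ y, -((𝓕 G y).re * f y) := by
    refine Continuous.integral_pos_of_hasCompactSupport_nonneg_nonzero (x := x)
      (hcont.mul hfs.continuous).neg (hfc.mul_left.comp_left (g := fun y : ℝ => -y) neg_zero) ?_ ?_
    · intro y
      by_cases hy : f y = 0
      · simp [hy]
      · have : (𝓕 G y).re < 0 := hfsub (subset_tsupport f hy)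
        simp only [Pi.zero_apply]
        nlinarith [hf0 y]
    · rw [hfx]; simpa using hx.ne
  rw [integral_neg] at hneg
  linarith

/-- Locally finite measures are determined by smooth compactly supported functions. -/
lemma ext_of_integral_contDiff {μ ρ : Measure E} [IsLocallyFiniteMeasure μ]
    [IsLocallyFiniteMeasure ρ]
    (h : ∀ f : E → ℝ, HasCompactSupport f → ContDiff ℝ ∞ f → ∫ x, f x ∂μ = ∫ x, f x ∂ρ) :
    μ = ρ := by
  refine Measure.OuterRegular.ext_isOpen_isBounded fun U hU hb => ?_
  obtain ⟨f, hfU, hfs, hfr⟩ := hU.exists_contDiff_support_eq (n := ⊤)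
  have hr : ∀ x, 0 ≤ f x ∧ f x ≤ 1 := fun x => hfr ⟨x, rfl⟩
  have hK : IsCompact (closure U) := hb.isCompact_closure
  -- The functions $1-(1-f)^n$ are smooth, vanish off `U` and tend to the indicator of `U`, because
  -- the support of `f` is exactly `U`.
  have hg0 : ∀ (n : ℕ) (x : E), x ∉ U → 1 - (1 - f x) ^ n = 0 := by
    intro n x hx
    have : f x = 0 := by rw [← hfU] at hx; simpa using hx
    simp [this]
  have key : ∀ m : Measure E, IsLocallyFiniteMeasure m →
      Tendsto (fun n : ℕ => ∫ x, (1 - (1 - f x) ^ n) ∂m) atTop (𝓝 (m.real U)) := by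
    intro m _
    have hfin : m U ≠ ⊤ := (hb.measure_lt_top).ne
    have : m.real U = ∫ x, U.indicator (fun _ => (1 : ℝ)) x ∂m := by
      rw [integral_indicator hU.measurableSet]; simp
    rw [this]
    refine tendsto_integral_of_dominated_convergence (U.indicator fun _ => (1 : ℝ))
      (fun n => ?_) ?_ (fun n => ae_of_all _ fun x => ?_) (ae_of_all _ fun x => ?_)
    · exact Continuous.aestronglyMeasurable (by have := hfs.continuous; fun_prop)
    · rw [integrable_indicator_iff hU.measurableSet]
      exact integrableOn_const hfin
    · by_cases hx : x ∈ U
      · simp only [hx, Set.indicator_of_mem]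
        have h1 : (1 - f x) ^ n ≤ 1 := pow_le_one₀ (by linarith [hr x]) (by linarith [hr x])
        have h2 : 0 ≤ (1 - f x) ^ n := pow_nonneg (by linarith [hr x]) n
        rw [Real.norm_eq_abs, abs_le]; constructor <;> linarith
      · simp [hx, hg0 n x hx]
    · by_cases hx : x ∈ U
      · simp only [hx, Set.indicator_of_mem]
        have hne : f x ≠ 0 := by rw [← hfU] at hx; exact hx
        have : 0 < f x := lt_of_le_of_ne (hr x).1 (Ne.symm hne)
        simpa using (tendsto_pow_atTop_nhds_zero_of_lt_one (r := 1 - f x)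
          (by linarith [hr x]) (by linarith)).const_sub 1
      · simp [hx, hg0 _ x hx]
  have heq : μ.real U = ρ.real U := by
    refine tendsto_nhds_unique (key μ inferInstance) ?_
    refine (key ρ inferInstance).congr fun n => (h _ ?_ ?_).symm
    · exact HasCompactSupport.intro hK fun x hx => hg0 n x fun h => hx (subset_closure h)
    · exact contDiff_const.sub ((contDiff_const.sub hfs).pow n)
  exact (measureReal_eq_measureReal_iff hb.measure_lt_top.ne hb.measure_lt_top.ne).1 heq

/-- Fourier inversion for finite measures with integrable characteristic function. -/
lemma eq_withDensity_of_charFun_eq (μ : Measure E) [IsProbabilityMeasure μ] {G : E → ℂ}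
    (hG : Integrable G) (h : ∀ v, charFun μ ((2 * Real.pi) • v) = G v) :
    μ = volume.withDensity fun x => ENNReal.ofReal (𝓕 G x).re := by
  have hcont : Continuous fun y => (𝓕 G y).re :=
    Complex.continuous_re.comp (continuous_fourier_of_integrable hG)
  have h0 : ∀ x, 0 ≤ (𝓕 G x).re :=
    fourier_re_nonneg hG (fun _ => μ) fun v => by rw [h v]; exact tendsto_const_nhds
  have : IsLocallyFiniteMeasure (volume.withDensity fun x => ENNReal.ofReal (𝓕 G x).re) :=
    IsLocallyFiniteMeasure.withDensity_ofReal hcont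
  refine ext_of_integral_contDiff fun f hfc hfs => ?_
  rw [integral_eq_re_integral_charFun μ hfc hfs]
  simp only [h]
  rw [← integral_re_fourier_mul hG,
    integral_withDensity_eq_integral_toReal_smul hcont.measurable.ennreal_ofReal (by simp)]
  refine integral_congr_ae (ae_of_all _ fun x => ?_)
  simp [ENNReal.toReal_ofReal (h0 x)]

/-- Fourier transform of a product with a characteristic function. -/
lemma fourier_mul_charFun_re {G : E → ℂ} (hG : Integrable G) (Q : Measure E) [IsFiniteMeasure Q]
    (x : E) :
    (𝓕 (fun v => G v * charFun Q ((2 * Real.pi) • v)) x).re = ∫ z, (𝓕 G (x - z)).re ∂Q := by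
  have hint : Integrable (fun z => 𝓕 G (x - z)) Q := by
    refine Integrable.of_bound (C := ∫ v, ‖G v‖) ?_ (ae_of_all _ fun z => ?_)
    · exact ((continuous_fourier_of_integrable hG).comp (by fun_prop)).aestronglyMeasurable
    · exact VectorFourier.norm_fourierIntegral_le_integral_norm _ _ _ _ _
  have hmain : 𝓕 (fun v => G v * charFun Q ((2 * Real.pi) • v)) x = ∫ z, 𝓕 G (x - z) ∂Q := by
    simp only [Real.fourier_eq', charFun_apply, smul_eq_mul]
    rw [integral_integral_swap]
    · refine integral_congr_ae (ae_of_all _ fun v => ?_)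
      simp only
      rw [mul_left_comm, ← integral_const_mul, ← integral_const_mul]
      refine integral_congr_ae (ae_of_all _ fun z => ?_)
      simp only
      rw [mul_comm (G v), ← Complex.exp_add]
      congr 2
      rw [inner_sub_right, inner_smul_right, real_inner_comm v z]
      push_cast
      ring
    · have hGs : AEStronglyMeasurable (fun p : E × E => G p.2) (Q.prod volume) := hG.1.comp_snd
      have hb : Integrable (fun p : E × E => (1 : ℝ) * ‖G p.2‖) (Q.prod volume) :=
        (integrable_const (1 : ℝ)).mul_prod hG.norm
      refine hb.mono' ?_ (ae_of_all _ fun p => ?_)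
      · refine AEStronglyMeasurable.mul (Continuous.aestronglyMeasurable ?_) hGs
        fun_prop
      · rw [Function.uncurry_apply_pair, norm_mul, Complex.norm_exp_ofReal_mul_I]
  rw [hmain, ← Complex.reCLM_apply, ← ContinuousLinearMap.integral_comp_comm _ hint]
  rfl

end FourierInversion

/-! ### Compound Poisson measures. -/

section CompoundPoisson

set_option linter.unusedSectionVars false

variable {E : Type*} [NormedAddCommGroup E] [InnerProductSpace ℝ E] [FiniteDimensional ℝ E]
  [MeasurableSpace E] [BorelSpace E]

/-- Convolution powers of a measure. -/
noncomputable def convPow (m : Measure E) : ℕ → Measure E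
  | 0 => Measure.dirac 0
  | k + 1 => m.conv (convPow m k)

lemma isFiniteMeasure_convPow (m : Measure E) [IsFiniteMeasure m] (k : ℕ) :
    IsFiniteMeasure (convPow m k) := by
  induction k with
  | zero => rw [convPow]; infer_instance
  | succ k ih => rw [convPow]; infer_instance

lemma charFun_convPow (m : Measure E) [IsFiniteMeasure m] (k : ℕ) (ξ : E) :
    charFun (convPow m k) ξ = charFun m ξ ^ k := by
  induction k with
  | zero => simp [convPow]
  | succ k ih =>
    have := isFiniteMeasure_convPow m k
    rw [convPow, charFun_conv, ih, pow_succ']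

/-- The total mass is the characteristic function at the origin. -/
lemma measureReal_convPow_univ (m : Measure E) [IsFiniteMeasure m] (k : ℕ) :
    (convPow m k).real Set.univ = m.real Set.univ ^ k := by
  have h := charFun_convPow m k 0
  rw [charFun_zero, charFun_zero] at h
  exact_mod_cast h

/-- The unnormalized compound Poisson measure `∑ m^{*k} / k!`. -/
noncomputable def expMeasure (m : Measure E) : Measure E :=
  Measure.sum fun k : ℕ => ENNReal.ofReal ((k.factorial : ℝ)⁻¹) • convPow m k

lemma isFiniteMeasure_expMeasure (m : Measure E) [IsFiniteMeasure m] :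
    IsFiniteMeasure (expMeasure m) := by
  constructor
  rw [expMeasure, Measure.sum_apply _ MeasurableSet.univ]
  have h : ∀ k : ℕ, (ENNReal.ofReal ((k.factorial : ℝ)⁻¹) • convPow m k) Set.univ
      = ENNReal.ofReal (m.real Set.univ ^ k / k.factorial) := by
    intro k
    have := isFiniteMeasure_convPow m k
    rw [Measure.smul_apply, smul_eq_mul, ← ofReal_measureReal, measureReal_convPow_univ,
      ← ENNReal.ofReal_mul (by positivity)]
    congr 1; ring
  simp_rw [h]
  exact (Real.summable_pow_div_factorial _).tsum_ofReal_lt_top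

lemma charFun_expMeasure (m : Measure E) [IsFiniteMeasure m] (ξ : E) :
    charFun (expMeasure m) ξ = Complex.exp (charFun m ξ) := by
  have := isFiniteMeasure_expMeasure m
  have hi : Integrable (fun x => Complex.exp (inner ℝ x ξ * Complex.I)) (expMeasure m) :=
    Integrable.of_bound (C := 1) (Continuous.aestronglyMeasurable (by fun_prop))
      (ae_of_all _ fun x => by simp [Complex.norm_exp_ofReal_mul_I])
  have h1 := hasSum_integral_measure hi
  have h2 : ∀ k : ℕ, ∫ x, Complex.exp (inner ℝ x ξ * Complex.I)
      ∂(ENNReal.ofReal ((k.factorial : ℝ)⁻¹) • convPow m k) = charFun m ξ ^ k / k.factorial := by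
    intro k
    rw [integral_smul_measure, ← charFun_apply, charFun_convPow,
      ENNReal.toReal_ofReal (by positivity), Complex.real_smul]
    push_cast
    ring
  simp_rw [h2] at h1
  rw [charFun_apply]
  refine h1.unique ?_
  rw [Complex.exp_eq_exp_ℂ]
  exact NormedSpace.expSeries_div_hasSum_exp (charFun m ξ)

/-- The compound Poisson probability measure with jump measure `m`. -/
noncomputable def compoundPoisson (m : Measure E) : Measure E :=
  ENNReal.ofReal (Real.exp (-m.real Set.univ)) • expMeasure m

lemma charFun_compoundPoisson (m : Measure E) [IsFiniteMeasure m] (ξ : E) :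
    charFun (compoundPoisson m) ξ = Complex.exp (charFun m ξ - m.real Set.univ) := by
  rw [compoundPoisson, charFun_apply, integral_smul_measure, ← charFun_apply, charFun_expMeasure,
    ENNReal.toReal_ofReal (Real.exp_pos _).le, Complex.real_smul, Complex.ofReal_exp,
    ← Complex.exp_add]
  congr 1
  push_cast
  ring

lemma isProbabilityMeasure_compoundPoisson (m : Measure E) [IsFiniteMeasure m] :
    IsProbabilityMeasure (compoundPoisson m) := by
  have := isFiniteMeasure_expMeasure m
  have hf : IsFiniteMeasure (compoundPoisson m) := by
    rw [compoundPoisson]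
    exact Measure.smul_finite _ ENNReal.ofReal_ne_top
  have h := charFun_compoundPoisson m 0
  rw [charFun_zero, charFun_zero, sub_self, Complex.exp_zero] at h
  have h' : (compoundPoisson m).real Set.univ = 1 := by exact_mod_cast h
  constructor
  rw [← ofReal_measureReal, h', ENNReal.ofReal_one]

/-- Only the term $k=1$ of the exponential series is kept: exactly one jump. -/
lemma le_compoundPoisson (m : Measure E) [IsFiniteMeasure m] (s : Set E) :
    ENNReal.ofReal (Real.exp (-m.real Set.univ)) * m s ≤ compoundPoisson m s := by
  rw [compoundPoisson, Measure.smul_apply, smul_eq_mul]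
  gcongr
  have h := Measure.le_sum (fun k : ℕ => ENNReal.ofReal ((k.factorial : ℝ)⁻¹) • convPow m k) 1
  have h1 : ENNReal.ofReal (((1 : ℕ).factorial : ℝ)⁻¹) • convPow m 1 = m := by
    simp [convPow]
  simp only [h1] at h
  exact h

end CompoundPoisson

/-! ### Densities with Fourier transform $e^{-t\Psi}$, where $\Psi$ grows at least like
$|v|^\alpha$. -/

section StretchedExponential

set_option linter.unusedSectionVars false

variable {E : Type*} [NormedAddCommGroup E] [InnerProductSpace ℝ E] [FiniteDimensional ℝ E]
  [MeasurableSpace E] [BorelSpace E]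

/-- Polar coordinates reduce this to a Gamma integral. All moments are needed, since the $n$-th one
controls the $n$-th derivative of the density. -/
lemma integrable_norm_pow_mul_exp_neg_rpow [Nontrivial E] (n : ℕ) {b α : ℝ} (hb : 0 < b)
    (hα : 0 < α) : Integrable fun v : E => ‖v‖ ^ n * Real.exp (-(b * ‖v‖ ^ α)) := by
  rw [integrable_fun_norm_addHaar volume (f := fun r : ℝ => r ^ n * Real.exp (-(b * r ^ α)))]
  have h := integrableOn_rpow_mul_exp_neg_mul_rpow (p := α) (b := b)
    (s := ((Module.finrank ℝ E - 1 + n : ℕ) : ℝ))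
    (by have : (0 : ℝ) ≤ ((Module.finrank ℝ E - 1 + n : ℕ) : ℝ) := Nat.cast_nonneg _
        linarith) hα hb
  refine h.congr_fun (fun r _ => ?_) measurableSet_Ioi
  simp only [Real.rpow_natCast, pow_add, smul_eq_mul, neg_mul]
  ring

/-- The factor $e^{tb}$ pays for the unit ball, where no growth of `Ψ` is assumed but
$tb\|v\|^\alpha\le tb$. -/
lemma exp_neg_mul_le_of_growth {Ψ : E → ℝ} {b α t : ℝ} (hb : 0 ≤ b) (hα : 0 < α) (ht : 0 ≤ t)
    (h0 : ∀ v, 0 ≤ Ψ v) (hlow : ∀ v, 1 < ‖v‖ → b * ‖v‖ ^ α ≤ Ψ v) (v : E) :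
    Real.exp (-(t * Ψ v)) ≤ Real.exp (t * b) * Real.exp (-(t * b * ‖v‖ ^ α)) := by
  rw [← Real.exp_add, Real.exp_le_exp]
  have htb : 0 ≤ t * b := mul_nonneg ht hb
  by_cases hv : 1 < ‖v‖
  · have := mul_le_mul_of_nonneg_left (hlow v hv) ht
    linarith
  · have h1 : ‖v‖ ^ α ≤ 1 := Real.rpow_le_one (norm_nonneg _) (not_lt.1 hv) hα.le
    have h2 := mul_le_mul_of_nonneg_left h1 htb
    have h3 := mul_nonneg ht (h0 v)
    linarith

lemma integrable_norm_pow_mul_exp_neg [Nontrivial E] {Ψ : E → ℝ} {b α t : ℝ} (hb : 0 < b)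
    (hα : 0 < α) (ht : 0 < t) (hm : Measurable Ψ) (h0 : ∀ v, 0 ≤ Ψ v)
    (hlow : ∀ v, 1 < ‖v‖ → b * ‖v‖ ^ α ≤ Ψ v) (n : ℕ) :
    Integrable fun v : E => ‖v‖ ^ n * Real.exp (-(t * Ψ v)) := by
  refine ((integrable_norm_pow_mul_exp_neg_rpow (E := E) n (mul_pos ht hb) hα).const_mul
    (Real.exp (t * b))).mono' (by fun_prop) (ae_of_all _ fun v => ?_)
  rw [Real.norm_of_nonneg (by positivity), mul_left_comm]
  gcongr
  exact exp_neg_mul_le_of_growth hb.le hα ht.le h0 hlow v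

/-- The real part of the Fourier transform of `exp (-t Ψ)`. -/
noncomputable def expDensity (Ψ : E → ℝ) (t : ℝ) (x : E) : ℝ :=
  (𝓕 (fun v => ((Real.exp (-(t * Ψ v)) : ℝ) : ℂ)) x).re

lemma integrable_ofReal_exp_neg [Nontrivial E] {Ψ : E → ℝ} {b α t : ℝ} (hb : 0 < b)
    (hα : 0 < α) (ht : 0 < t) (hm : Measurable Ψ) (h0 : ∀ v, 0 ≤ Ψ v)
    (hlow : ∀ v, 1 < ‖v‖ → b * ‖v‖ ^ α ≤ Ψ v) :
    Integrable fun v : E => ((Real.exp (-(t * Ψ v)) : ℝ) : ℂ) := by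
  have := integrable_norm_pow_mul_exp_neg hb hα ht hm h0 hlow 0
  simp only [pow_zero, one_mul] at this
  exact this.ofReal

lemma contDiff_expDensity [Nontrivial E] {Ψ : E → ℝ} {b α t : ℝ} (hb : 0 < b)
    (hα : 0 < α) (ht : 0 < t) (hm : Measurable Ψ) (h0 : ∀ v, 0 ≤ Ψ v)
    (hlow : ∀ v, 1 < ‖v‖ → b * ‖v‖ ^ α ≤ Ψ v) : ContDiff ℝ ∞ (expDensity Ψ t) := by
  refine Complex.reCLM.contDiff.comp (Real.contDiff_fourier fun n _ => ?_)
  simp only [Complex.norm_real, Real.norm_of_nonneg (Real.exp_pos _).le]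
  exact integrable_norm_pow_mul_exp_neg hb hα ht hm h0 hlow n

lemma expDensity_le (Ψ : E → ℝ) (t : ℝ) (x : E) :
    expDensity Ψ t x ≤ ∫ v, Real.exp (-(t * Ψ v)) := by
  refine (Complex.re_le_norm _).trans
    ((VectorFourier.norm_fourierIntegral_le_integral_norm _ _ _ _ _).trans_eq ?_)
  simp only [Complex.norm_real, Real.norm_of_nonneg (Real.exp_pos _).le]

lemma expDensity_eq_integral_cos [Nontrivial E] {Ψ : E → ℝ} {b α t : ℝ} (hb : 0 < b)
    (hα : 0 < α) (ht : 0 < t) (hm : Measurable Ψ) (h0 : ∀ v, 0 ≤ Ψ v)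
    (hlow : ∀ v, 1 < ‖v‖ → b * ‖v‖ ^ α ≤ Ψ v) (x : E) :
    expDensity Ψ t x = ∫ v, Real.cos (2 * Real.pi * inner ℝ v x) * Real.exp (-(t * Ψ v)) := by
  have hi := integrable_ofReal_exp_neg hb hα ht hm h0 hlow
  rw [expDensity, Real.fourier_eq', ← Complex.reCLM_apply,
    ← ContinuousLinearMap.integral_comp_comm]
  · refine integral_congr_ae (ae_of_all _ fun v => ?_)
    simp only [Complex.reCLM_apply, smul_eq_mul, Complex.re_mul_ofReal, Complex.exp_ofReal_mul_I_re]
    rw [neg_mul, neg_mul, Real.cos_neg]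
  · have hc : Continuous fun v : E =>
        Complex.exp (((-2 * Real.pi * inner ℝ v x : ℝ) : ℂ) * Complex.I) := by fun_prop
    refine hi.norm.mono' (hc.aestronglyMeasurable.smul hi.1)
      (ae_of_all _ fun v => ?_)
    rw [norm_smul, Complex.norm_exp_ofReal_mul_I, one_mul]

/-- Lower bound for the density near the origin, uniform over exponents comparable with
`‖v‖ ^ α` at infinity. -/
lemma exists_forall_le_expDensity [Nontrivial E] {b K α : ℝ} (hb : 0 < b) (hK : 0 ≤ K)
    (hα : 0 < α) :
    ∃ κ > 0, ∃ δ > 0, ∀ Ψ : E → ℝ, Measurable Ψ → (∀ v, 0 ≤ Ψ v) →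
      (∀ v, 1 < ‖v‖ → b * ‖v‖ ^ α ≤ Ψ v) → (∀ v, 1 ≤ ‖v‖ → Ψ v ≤ K * ‖v‖ ^ α) →
      ∀ t : ℝ, 0 < t → t < 1 → ∀ x : E, ‖x‖ ≤ δ * t ^ (1 / α) →
        κ * t ^ (-(Module.finrank ℝ E : ℝ) / α) ≤ expDensity Ψ t x := by
  -- On this annulus the upper bound for `Ψ` is available, also after dilation by a factor at least
  -- 1. It bounds the integral of the rescaled exponential below by `l`, while `M` bounds its first
  -- moment above; `δ` is chosen so that $2\pi\delta M\le l/2$.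
  set S : Set E := Metric.ball 0 2 \ Metric.closedBall 0 1 with hS
  have hSo : IsOpen S := Metric.isOpen_ball.sdiff Metric.isClosed_closedBall
  have hSne : S.Nonempty := by
    obtain ⟨v, hv⟩ := exists_norm_eq E (c := 3 / 2) (by norm_num)
    exact ⟨v, by simp [hS, hv]; norm_num⟩
  have hSfin : volume S ≠ ⊤ :=
    ((measure_mono Set.sdiff_subset).trans_lt Metric.isBounded_ball.measure_lt_top).ne
  have hSpos : 0 < volume.real S := by
    rw [measureReal_def]
    exact ENNReal.toReal_pos (hSo.measure_pos volume hSne).ne' hSfin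
  set l : ℝ := Real.exp (-(K * 2 ^ α)) * volume.real S with hl
  have hlpos : 0 < l := by positivity
  set M : ℝ := Real.exp b * ∫ v : E, ‖v‖ * Real.exp (-(b * ‖v‖ ^ α)) with hM
  have hM0 : 0 ≤ M := by
    refine mul_nonneg (Real.exp_pos _).le (integral_nonneg fun v => ?_)
    exact mul_nonneg (norm_nonneg _) (Real.exp_pos _).le
  have hMpos : 0 < 2 * Real.pi * M + 1 := by positivity
  refine ⟨l / 2, by positivity, l / (2 * (2 * Real.pi * M + 1)), by positivity, ?_⟩
  intro Ψ hm h0 hlow hup t ht ht1 x hx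
  set δ := l / (2 * (2 * Real.pi * M + 1)) with hδ
  have hδpos : 0 < δ := by positivity
  -- Dilation by `s` preserves the constants `b` and `K`, as $ts^\alpha=1$, and its Jacobian is the
  -- factor $t^{-d/\alpha}$. Since $t<1$ gives $s\ge1$, points outside the unit ball stay outside.
  set s : ℝ := t ^ (-(1 / α)) with hs
  have hspos : 0 < s := Real.rpow_pos_of_pos ht _
  have hs1 : 1 ≤ s := Real.one_le_rpow_of_pos_of_le_one_of_nonpos ht ht1.le
    (by rw [neg_nonpos]; positivity)
  have hsα : t * s ^ α = 1 := by
    rw [hs, ← Real.rpow_mul ht.le, neg_mul, one_div_mul_cancel hα.ne', Real.rpow_neg_one,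
      mul_inv_cancel₀ ht.ne']
  have hsn : s ^ Module.finrank ℝ E = t ^ (-(Module.finrank ℝ E : ℝ) / α) := by
    rw [← Real.rpow_natCast, hs, ← Real.rpow_mul ht.le]
    congr 1; ring
  have hst : t ^ (1 / α) * s = 1 := by
    rw [hs, ← Real.rpow_add ht, add_neg_cancel, Real.rpow_zero]
  set F : E → ℝ := fun v => Real.exp (-(t * Ψ (s • v))) with hF
  have hFup : ∀ v, F v ≤ Real.exp b * Real.exp (-(b * ‖v‖ ^ α)) := by
    intro v
    have h := exp_neg_mul_le_of_growth (Ψ := fun v => t * Ψ (s • v)) (t := 1) hb.le hα zero_le_one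
      (fun v => mul_nonneg ht.le (h0 _)) (fun v hv => ?_) v
    · simpa only [one_mul] using h
    · have h1 : ‖s • v‖ = s * ‖v‖ := by rw [norm_smul, Real.norm_of_nonneg hspos.le]
      have h2 := hlow (s • v) (by rw [h1]; nlinarith)
      rw [h1, Real.mul_rpow hspos.le (norm_nonneg _)] at h2
      calc b * ‖v‖ ^ α = t * (b * (s ^ α * ‖v‖ ^ α)) := by
            linear_combination (-(b * ‖v‖ ^ α)) * hsα
        _ ≤ _ := mul_le_mul_of_nonneg_left h2 ht.le
  have hFm : Measurable F := by fun_prop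
  have hFn : ∀ n : ℕ, Integrable fun v => ‖v‖ ^ n * F v := by
    intro n
    refine ((integrable_norm_pow_mul_exp_neg_rpow (E := E) n hb hα).const_mul
      (Real.exp b)).mono' (by fun_prop) (ae_of_all _ fun v => ?_)
    rw [Real.norm_of_nonneg (mul_nonneg (by positivity) (Real.exp_pos _).le), mul_left_comm]
    exact mul_le_mul_of_nonneg_left (hFup v) (by positivity)
  have hF0 : Integrable F := by simpa using hFn 0
  have hF1 : Integrable fun v => ‖v‖ * F v := by simpa using hFn 1
  have hI1 : ∫ v, ‖v‖ * F v ≤ M := by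
    rw [hM, ← integral_const_mul]
    refine integral_mono hF1 ?_ fun v => ?_
    · simpa using (integrable_norm_pow_mul_exp_neg_rpow (E := E) 1 hb hα).const_mul (Real.exp b)
    · have := mul_le_mul_of_nonneg_left (hFup v) (norm_nonneg v)
      simp only
      linarith
  have hI0 : l ≤ ∫ v, F v := by
    calc l = ∫ v in S, Real.exp (-(K * 2 ^ α)) := by
          rw [setIntegral_const, smul_eq_mul, mul_comm]
      _ ≤ ∫ v in S, F v := by
          refine setIntegral_mono_on (integrableOn_const hSfin) hF0.integrableOn
            hSo.measurableSet fun v hv => ?_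
          simp only [hS, Set.mem_sdiff, Metric.mem_ball, dist_zero_right, Metric.mem_closedBall,
            not_le] at hv
          have h1 : ‖s • v‖ = s * ‖v‖ := by rw [norm_smul, Real.norm_of_nonneg hspos.le]
          have h2 := hup (s • v) (by rw [h1]; nlinarith)
          rw [h1, Real.mul_rpow hspos.le (norm_nonneg _)] at h2
          have h3 : ‖v‖ ^ α ≤ 2 ^ α := Real.rpow_le_rpow (norm_nonneg _) hv.1.le hα.le
          rw [hF, Real.exp_le_exp, neg_le_neg_iff]
          calc t * Ψ (s • v) ≤ t * (K * (s ^ α * ‖v‖ ^ α)) := mul_le_mul_of_nonneg_left h2 ht.le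
            _ = K * ‖v‖ ^ α := by linear_combination (K * ‖v‖ ^ α) * hsα
            _ ≤ K * 2 ^ α := mul_le_mul_of_nonneg_left h3 hK
      _ ≤ ∫ v, F v := setIntegral_le_integral hF0 (ae_of_all _ fun v => (Real.exp_pos _).le)
  have hscale : expDensity Ψ t x = s ^ Module.finrank ℝ E *
      ∫ v, Real.cos (2 * Real.pi * inner ℝ (s • v) x) * F v := by
    rw [expDensity_eq_integral_cos hb hα ht hm h0 hlow,
      Measure.integral_comp_smul_of_nonneg volume
        (fun v => Real.cos (2 * Real.pi * inner ℝ v x) * Real.exp (-(t * Ψ v))) s (hR := hspos.le),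
      smul_eq_mul, ← mul_assoc, mul_inv_cancel₀ (by positivity), one_mul]
  -- By $\cos u\ge1-|u|$, the oscillation costs at most $2\pi\delta$ times the first moment.
  have hcos : ∀ v, F v - 2 * Real.pi * δ * (‖v‖ * F v) ≤
      Real.cos (2 * Real.pi * inner ℝ (s • v) x) * F v := by
    intro v
    have hFv : 0 ≤ F v := (Real.exp_pos _).le
    have h1 : |inner ℝ (s • v) x| ≤ δ * ‖v‖ := by
      refine (abs_real_inner_le_norm _ _).trans ?_
      rw [norm_smul, Real.norm_of_nonneg hspos.le]
      calc s * ‖v‖ * ‖x‖ ≤ s * ‖v‖ * (δ * t ^ (1 / α)) := by gcongr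
        _ = δ * ‖v‖ := by linear_combination (δ * ‖v‖) * hst
    have h2 : ∀ u : ℝ, 1 - |u| ≤ Real.cos u := by
      intro u
      by_cases hu : |u| ≤ 2
      · have := Real.one_sub_sq_div_two_le_cos (x := u)
        rw [← sq_abs] at this
        nlinarith [abs_nonneg u]
      · linarith [Real.neg_one_le_cos u, not_le.1 hu]
    have h3 := h2 (2 * Real.pi * inner ℝ (s • v) x)
    rw [abs_mul, abs_of_pos (by positivity : (0 : ℝ) < 2 * Real.pi)] at h3
    have h4 : 1 - 2 * Real.pi * (δ * ‖v‖) ≤ Real.cos (2 * Real.pi * inner ℝ (s • v) x) := by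
      have := mul_le_mul_of_nonneg_left h1 (by positivity : (0 : ℝ) ≤ 2 * Real.pi)
      linarith
    have := mul_le_mul_of_nonneg_right h4 hFv
    linarith
  have hcosint : Integrable fun v => Real.cos (2 * Real.pi * inner ℝ (s • v) x) * F v := by
    refine hF0.mono' (by fun_prop) (ae_of_all _ fun v => ?_)
    rw [norm_mul, Real.norm_of_nonneg (Real.exp_pos _).le]
    exact mul_le_of_le_one_left (Real.exp_pos _).le (Real.abs_cos_le_one _)
  have hmain : l / 2 ≤ ∫ v, Real.cos (2 * Real.pi * inner ℝ (s • v) x) * F v := by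
    refine le_trans ?_ (integral_mono (hF0.sub (hF1.const_mul _)) hcosint hcos)
    rw [integral_sub' hF0 (hF1.const_mul _), integral_const_mul]
    have h1 : 2 * Real.pi * δ * ∫ v, ‖v‖ * F v ≤ 2 * Real.pi * δ * M := by gcongr
    have h2 : 2 * Real.pi * δ * M ≤ l / 2 := by
      have : δ * (2 * Real.pi * M + 1) = l / 2 := by rw [hδ]; field_simp
      nlinarith
    linarith
  rw [hscale, ← hsn, mul_comm]
  gcongr

end StretchedExponential

/-! ### Bounds for the Lévy exponent, and positivity of the density. -/

section LevyExponent

variable {d : ℕ} {ν : Measure (EuclideanSpace ℝ (Fin d))}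

lemma one_sub_cos_le_two_mul_min_sq {E : Type*} [NormedAddCommGroup E] [InnerProductSpace ℝ E]
    (ξ y : E) : 1 - Real.cos (inner ℝ ξ y) ≤ 2 * (min 1 (‖ξ‖ * ‖y‖)) ^ 2 := by
  rcases le_total 1 (‖ξ‖ * ‖y‖) with h | h
  · rw [min_eq_left h]
    linarith [Real.neg_one_le_cos (inner ℝ ξ y)]
  · rw [min_eq_right h]
    have h1 := Real.one_sub_sq_div_two_le_cos (x := inner ℝ ξ y)
    have h2 : (inner ℝ ξ y : ℝ) ^ 2 ≤ (‖ξ‖ * ‖y‖) ^ 2 := by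
      rw [← sq_abs]
      exact pow_le_pow_left₀ (abs_nonneg _) (abs_real_inner_le_norm _ _) 2
    nlinarith [sq_nonneg (‖ξ‖ * ‖y‖)]

/-- A majorant that is integrable for a Lévy measure and locally uniform in `ξ`; it gives
integrability and the continuity of the exponent. -/
lemma one_sub_cos_le_mul_min {E : Type*} [NormedAddCommGroup E] [InnerProductSpace ℝ E]
    (ξ y : E) : 1 - Real.cos (inner ℝ ξ y) ≤ 2 * (1 + ‖ξ‖ ^ 2) * min 1 (‖y‖ ^ 2) := by
  have h := one_sub_cos_le_two_mul_min_sq ξ y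
  rcases le_total 1 (‖y‖ ^ 2) with hy | hy
  · rw [min_eq_left hy]
    nlinarith [sq_nonneg ‖ξ‖, Real.neg_one_le_cos (inner ℝ ξ y)]
  · rw [min_eq_right hy]
    have h1 : (min 1 (‖ξ‖ * ‖y‖)) ^ 2 ≤ (‖ξ‖ * ‖y‖) ^ 2 :=
      pow_le_pow_left₀ (by positivity) (min_le_right _ _) 2
    nlinarith [sq_nonneg ‖y‖]

lemma one_sub_cos_nonneg (u : ℝ) : 0 ≤ 1 - Real.cos u := by linarith [Real.cos_le_one u]

lemma integrable_min_one_sq (h : ∫⁻ y, ENNReal.ofReal (min 1 (‖y‖ ^ 2)) ∂ν < ⊤) :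
    Integrable (fun y => min 1 (‖y‖ ^ 2)) ν := by
  refine ⟨by fun_prop, ?_⟩
  rw [hasFiniteIntegral_iff_ofReal (ae_of_all _ fun y => by positivity)]
  exact h

lemma integrable_one_sub_cos (h : ∫⁻ y, ENNReal.ofReal (min 1 (‖y‖ ^ 2)) ∂ν < ⊤)
    (ξ : EuclideanSpace ℝ (Fin d)) :
    Integrable (fun y => 1 - Real.cos (inner ℝ ξ y)) ν := by
  refine ((integrable_min_one_sq h).const_mul (2 * (1 + ‖ξ‖ ^ 2))).mono' (by fun_prop)
    (ae_of_all _ fun y => ?_)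
  rw [Real.norm_of_nonneg (one_sub_cos_nonneg _)]
  exact one_sub_cos_le_mul_min ξ y

lemma levyExponent_nonneg (ν : Measure (EuclideanSpace ℝ (Fin d)))
    (ξ : EuclideanSpace ℝ (Fin d)) : 0 ≤ levyExponent ν ξ :=
  integral_nonneg fun _ => one_sub_cos_nonneg _

lemma continuous_levyExponent (h : ∫⁻ y, ENNReal.ofReal (min 1 (‖y‖ ^ 2)) ∂ν < ⊤) :
    Continuous (levyExponent ν) := by
  rw [continuous_iff_continuousAt]
  intro ξ₀
  refine continuousAt_of_dominated (bound := fun y => 2 * (1 + (‖ξ₀‖ + 1) ^ 2) * min 1 (‖y‖ ^ 2))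
    (Eventually.of_forall fun ξ => by fun_prop) ?_ ((integrable_min_one_sq h).const_mul _)
    (ae_of_all _ fun y => by fun_prop)
  filter_upwards [Metric.ball_mem_nhds ξ₀ one_pos] with ξ hξ
  refine ae_of_all _ fun y => ?_
  rw [Real.norm_of_nonneg (one_sub_cos_nonneg _)]
  refine (one_sub_cos_le_mul_min ξ y).trans ?_
  have : ‖ξ‖ ≤ ‖ξ₀‖ + 1 := by
    have h1 : ‖ξ - ξ₀‖ < 1 := by simpa [dist_eq_norm] using hξ
    linarith [norm_le_norm_add_norm_sub' ξ ξ₀]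
  gcongr

/-- A tail bound on the Lévy measure yields a growth bound on the exponent. -/
lemma levyExponent_le_mul_rpow {α c₂ : ℝ} (hα2 : α < 2) (hc₂ : 0 ≤ c₂)
    (htail : ∀ r : ℝ, 0 < r → r < 1 →
      ν (Metric.ball (0 : EuclideanSpace ℝ (Fin d)) r)ᶜ ≤ ENNReal.ofReal (c₂ * r ^ (-α)))
    (ξ : EuclideanSpace ℝ (Fin d)) (hξ : 1 ≤ ‖ξ‖) :
    levyExponent ν ξ ≤ 4 * c₂ / (2 - α) * ‖ξ‖ ^ α := by
  have hξ0 : 0 < ‖ξ‖ := by linarith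
  have h2α : 0 < 2 - α := by linarith
  set f : EuclideanSpace ℝ (Fin d) → ℝ := fun y => min 1 (‖ξ‖ * ‖y‖) with hf
  have hf0 : ∀ y, 0 ≤ f y := fun y => by positivity
  have hfm : Measurable f := by fun_prop
  have hII : IntervalIntegrable (fun s : ℝ => s ^ (1 - α)) volume 0 1 :=
    intervalIntegral.intervalIntegrable_rpow' (by linarith)
  have hIv : ∫ s in (0 : ℝ)..1, s ^ (1 - α) = 1 / (2 - α) := by
    rw [integral_rpow (Or.inl (by linarith)), Real.one_rpow, Real.zero_rpow (by linarith)]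
    congr 1 <;> ring
  have hlay : ∫⁻ y, ENNReal.ofReal (f y ^ 2) ∂ν ≤
      ENNReal.ofReal (2 * c₂ / (2 - α) * ‖ξ‖ ^ α) := by
    have h := lintegral_rpow_eq_lintegral_meas_lt_mul ν (ae_of_all _ hf0) hfm.aemeasurable
      (p := 2) two_pos
    simp only [Real.rpow_two] at h
    rw [h]
    -- Layer cake: for $s<1$ the level set lies outside the ball of radius $s/\|\xi\|<1$, where the
    -- tail bound applies, and for $s\ge1$ it is empty. What remains is $\int_0^1s^{1-\alpha}\,ds$,
    -- finite because $\alpha<2$.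
    have hbound : ∀ s ∈ Set.Ioi (0 : ℝ),
        ν {y | s < f y} * ENNReal.ofReal (s ^ ((2 : ℝ) - 1)) ≤
          (Set.Ioc (0 : ℝ) 1).indicator
            (fun s => ENNReal.ofReal (c₂ * ‖ξ‖ ^ α * s ^ (1 - α))) s := by
      intro s hs
      have hs0 : 0 < s := hs
      by_cases hs1 : s < 1
      · rw [Set.indicator_of_mem (show s ∈ Set.Ioc (0 : ℝ) 1 from ⟨hs0, hs1.le⟩)]
        have hsub : {y | s < f y} ⊆ (Metric.ball 0 (s / ‖ξ‖))ᶜ := by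
          intro y hy
          have hy' : s < ‖ξ‖ * ‖y‖ := lt_of_lt_of_le hy (min_le_right _ _)
          simp only [Set.mem_compl_iff, Metric.mem_ball, dist_zero_right, not_lt]
          rw [div_le_iff₀ hξ0]
          linarith
        have hlt : s / ‖ξ‖ < 1 := by rw [div_lt_one hξ0]; linarith
        calc ν {y | s < f y} * ENNReal.ofReal (s ^ ((2 : ℝ) - 1))
            ≤ ENNReal.ofReal (c₂ * (s / ‖ξ‖) ^ (-α)) * ENNReal.ofReal (s ^ ((2 : ℝ) - 1)) := by
              gcongr
              exact (measure_mono hsub).trans (htail _ (by positivity) hlt)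
          _ = ENNReal.ofReal (c₂ * ‖ξ‖ ^ α * s ^ (1 - α)) := by
              rw [← ENNReal.ofReal_mul (by positivity)]
              congr 1
              have h21 : (2 : ℝ) - 1 = 1 := by norm_num
              rw [Real.div_rpow hs0.le hξ0.le, Real.rpow_neg hξ0.le, Real.rpow_sub hs0 1 α,
                Real.rpow_neg hs0.le, h21, Real.rpow_one]
              field_simp
      · have hempty : {y | s < f y} = ∅ := by
          ext y
          simp only [Set.mem_ofPred_eq, Set.mem_empty_iff_false, iff_false, not_lt]
          exact (min_le_left _ _).trans (not_lt.1 hs1)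
        rw [hempty]; simp
    calc ENNReal.ofReal 2 * ∫⁻ s in Set.Ioi 0, ν {y | s < f y} * ENNReal.ofReal (s ^ ((2 : ℝ) - 1))
        ≤ ENNReal.ofReal 2 * ∫⁻ s in Set.Ioi 0, (Set.Ioc (0 : ℝ) 1).indicator
            (fun s => ENNReal.ofReal (c₂ * ‖ξ‖ ^ α * s ^ (1 - α))) s := by
          gcongr ENNReal.ofReal 2 * ?_
          exact setLIntegral_mono' measurableSet_Ioi hbound
      _ = ENNReal.ofReal 2 * ∫⁻ s in Set.Ioc (0 : ℝ) 1,
            ENNReal.ofReal (c₂ * ‖ξ‖ ^ α * s ^ (1 - α)) := by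
          rw [lintegral_indicator measurableSet_Ioc, Measure.restrict_restrict measurableSet_Ioc,
            Set.inter_eq_self_of_subset_left Set.Ioc_subset_Ioi_self]
      _ = ENNReal.ofReal (2 * c₂ / (2 - α) * ‖ξ‖ ^ α) := by
          rw [← ofReal_integral_eq_lintegral_ofReal, ← ENNReal.ofReal_mul two_pos.le,
            integral_const_mul, ← intervalIntegral.integral_of_le zero_le_one, hIv]
          · congr 1; ring
          · exact ((intervalIntegrable_iff_integrableOn_Ioc_of_le zero_le_one).1 hII).const_mul _
          · refine (ae_restrict_iff' measurableSet_Ioc).2 (ae_of_all _ fun s hs => ?_)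
            have : 0 ≤ s ^ (1 - α) := Real.rpow_nonneg hs.1.le _
            simp only [Pi.zero_apply]
            positivity
  have hle : levyExponent ν ξ ≤ (∫⁻ y, ENNReal.ofReal (2 * f y ^ 2) ∂ν).toReal := by
    rw [levyExponent, integral_eq_lintegral_of_nonneg_ae
      (ae_of_all _ fun y => one_sub_cos_nonneg _) (by fun_prop)]
    refine ENNReal.toReal_mono ?_ (lintegral_mono fun y => ENNReal.ofReal_le_ofReal
      (one_sub_cos_le_two_mul_min_sq ξ y))
    simp_rw [ENNReal.ofReal_mul two_pos.le]
    rw [lintegral_const_mul _ (by fun_prop)]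
    exact ENNReal.mul_ne_top ENNReal.ofReal_ne_top (hlay.trans_lt ENNReal.ofReal_lt_top).ne
  refine hle.trans ?_
  simp_rw [ENNReal.ofReal_mul two_pos.le]
  rw [lintegral_const_mul _ (by fun_prop), ENNReal.toReal_mul, ENNReal.toReal_ofReal two_pos.le]
  have h3 := ENNReal.toReal_mono ENNReal.ofReal_ne_top hlay
  rw [ENNReal.toReal_ofReal (by positivity)] at h3
  calc 2 * (∫⁻ y, ENNReal.ofReal (f y ^ 2) ∂ν).toReal
      ≤ 2 * (2 * c₂ / (2 - α) * ‖ξ‖ ^ α) := by gcongr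
    _ = _ := by ring

lemma levyExponent_add {μ ρ : Measure (EuclideanSpace ℝ (Fin d))}
    (hμ : ∫⁻ y, ENNReal.ofReal (min 1 (‖y‖ ^ 2)) ∂μ < ⊤)
    (hρ : ∫⁻ y, ENNReal.ofReal (min 1 (‖y‖ ^ 2)) ∂ρ < ⊤) (ξ : EuclideanSpace ℝ (Fin d)) :
    levyExponent (μ + ρ) ξ = levyExponent μ ξ + levyExponent ρ ξ :=
  integral_add_measure (integrable_one_sub_cos hμ ξ) (integrable_one_sub_cos hρ ξ)

lemma levyExponent_smul (a : ENNReal) (ξ : EuclideanSpace ℝ (Fin d)) :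
    levyExponent (a • ν) ξ = a.toReal * levyExponent ν ξ := by
  rw [levyExponent, integral_smul_measure, smul_eq_mul, levyExponent]

/-- The characteristic function of a compound Poisson measure with symmetric jumps. -/
lemma charFun_compoundPoisson_of_symm (m : Measure (EuclideanSpace ℝ (Fin d))) [IsFiniteMeasure m]
    (hsymm : m.map (fun y => -y) = m) (ξ : EuclideanSpace ℝ (Fin d)) :
    charFun (compoundPoisson m) ξ = Complex.exp (-(levyExponent m ξ : ℝ)) := by
  rw [charFun_compoundPoisson]
  congr 1
  have hi : Integrable (fun x => Complex.exp (inner ℝ x ξ * Complex.I)) m :=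
    Integrable.of_bound (C := 1) (Continuous.aestronglyMeasurable (by fun_prop))
      (ae_of_all _ fun x => by simp [Complex.norm_exp_ofReal_mul_I])
  -- Symmetry of the jumps makes the characteristic function real, leaving only the cosine.
  have hconj : (starRingEnd ℂ) (charFun m ξ) = charFun m ξ := by
    rw [← charFun_neg]
    conv_rhs => rw [← hsymm]
    rw [charFun_apply, charFun_apply, integral_map (by fun_prop)
      (Continuous.aestronglyMeasurable (by fun_prop))]
    simp
  have hre : (charFun m ξ).re = ∫ y, Real.cos (inner ℝ ξ y) ∂m := by
    rw [charFun_apply, ← Complex.reCLM_apply, ← ContinuousLinearMap.integral_comp_comm _ hi]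
    refine integral_congr_ae (ae_of_all _ fun y => ?_)
    simp only [Complex.reCLM_apply, Complex.exp_ofReal_mul_I_re]
    rw [real_inner_comm]
  rw [← Complex.conj_eq_iff_re.1 hconj, hre, levyExponent, integral_sub (integrable_const _),
    integral_const]
  · push_cast; simp
  · exact Integrable.of_bound (C := 1) (by fun_prop)
      (ae_of_all _ fun y => by simpa using Real.abs_cos_le_one _)

lemma map_neg_restrict (hsymm : ν.map (fun y => -y) = ν) {S : Set (EuclideanSpace ℝ (Fin d))}
    (hS : MeasurableSet S) (hneg : (fun y => -y) ⁻¹' S = S) :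
    (ν.restrict S).map (fun y => -y) = ν.restrict S := by
  conv_rhs => rw [← hsymm]
  rw [Measure.restrict_map (by fun_prop) hS, hneg]

lemma neg_preimage_ball (r : ℝ) :
    (fun y : EuclideanSpace ℝ (Fin d) => -y) ⁻¹' Metric.ball 0 r = Metric.ball 0 r := by
  ext y; simp

lemma neg_preimage_compl_ball (r : ℝ) :
    (fun y : EuclideanSpace ℝ (Fin d) => -y) ⁻¹' (Metric.ball 0 r)ᶜ = (Metric.ball 0 r)ᶜ := by
  rw [Set.preimage_compl, neg_preimage_ball]

lemma measure_compl_ball_lt_top (h : ∫⁻ y, ENNReal.ofReal (min 1 (‖y‖ ^ 2)) ∂ν < ⊤) {r : ℝ}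
    (hr : 0 < r) : ν (Metric.ball (0 : EuclideanSpace ℝ (Fin d)) r)ᶜ < ⊤ := by
  have hpos : 0 < min 1 (r ^ 2) := by positivity
  refine lt_of_le_of_lt (measure_mono fun y hy => ?_)
    ((integrable_min_one_sq h).measure_ge_lt_top hpos)
  simp only [Set.mem_compl_iff, Metric.mem_ball, dist_zero_right, not_lt] at hy
  exact min_le_min_left 1 (pow_le_pow_left₀ hr.le hy 2)

/-- Densities obtained from symmetric Lévy measures by Fourier inversion are nonnegative. -/
lemma expDensity_levyExponent_nonneg (hν : IsSymmetricLevyMeasure ν) {t : ℝ} (ht : 0 ≤ t)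
    (hint : Integrable fun v : EuclideanSpace ℝ (Fin d) =>
      ((Real.exp (-(t * levyExponent ν ((2 * Real.pi) • v))) : ℝ) : ℂ))
    (x : EuclideanSpace ℝ (Fin d)) :
    0 ≤ expDensity (fun v => levyExponent ν ((2 * Real.pi) • v)) t x := by
  -- Discarding the jumps smaller than $1/(n+1)$ leaves a finite jump measure. The resulting
  -- compound Poisson characteristic functions converge to $e^{-t\Phi}$, so `fourier_re_nonneg`
  -- applies.
  set S : ℕ → Set (EuclideanSpace ℝ (Fin d)) := fun n => (Metric.ball 0 (1 / ((n : ℝ) + 1)))ᶜ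
    with hS
  have hSm : ∀ n, MeasurableSet (S n) := fun n => Metric.isOpen_ball.measurableSet.compl
  have hfin : ∀ n, IsFiniteMeasure (ν.restrict (S n)) := fun n =>
    ⟨by rw [Measure.restrict_apply_univ]
        exact measure_compl_ball_lt_top hν.lintegral_lt_top (by positivity)⟩
  have hfin' : ∀ n, IsFiniteMeasure (ENNReal.ofReal t • ν.restrict (S n)) := fun n =>
    Measure.smul_finite _ ENNReal.ofReal_ne_top
  have hprob : ∀ n, IsProbabilityMeasure (compoundPoisson (ENNReal.ofReal t • ν.restrict (S n))) :=
    fun n => isProbabilityMeasure_compoundPoisson _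
  refine fourier_re_nonneg hint
    (fun n => compoundPoisson (ENNReal.ofReal t • ν.restrict (S n))) (fun v => ?_) x
  have hchar : ∀ n, charFun (compoundPoisson (ENNReal.ofReal t • ν.restrict (S n)))
      ((2 * Real.pi) • v) =
      ((Real.exp (-(t * levyExponent (ν.restrict (S n)) ((2 * Real.pi) • v))) : ℝ) : ℂ) := by
    intro n
    rw [charFun_compoundPoisson_of_symm, levyExponent_smul, ENNReal.toReal_ofReal ht]
    · push_cast; rfl
    · rw [Measure.map_smul, map_neg_restrict hν.symm (hSm n) (neg_preimage_compl_ball _)]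
  simp only [hchar]
  refine (Complex.continuous_ofReal.tendsto _).comp ((Real.continuous_exp.tendsto _).comp
    (((Tendsto.const_mul t ?_)).neg))
  set ξ := (2 * Real.pi) • v
  have hind : ∀ n, levyExponent (ν.restrict (S n)) ξ =
      ∫ y, (S n).indicator (fun y => 1 - Real.cos (inner ℝ ξ y)) y ∂ν := fun n => by
    rw [integral_indicator (hSm n), levyExponent]
  simp only [hind]
  refine tendsto_integral_of_dominated_convergence (fun y => 1 - Real.cos (inner ℝ ξ y))
    (fun n => ((Continuous.aestronglyMeasurable (by fun_prop)).indicator (hSm n)))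
    (integrable_one_sub_cos hν.lintegral_lt_top ξ) (fun n => ae_of_all _ fun y => ?_)
    (ae_of_all _ fun y => ?_)
  · exact (norm_indicator_le_norm_self _ _).trans_eq
      (Real.norm_of_nonneg (one_sub_cos_nonneg _))
  -- The origin lies in no `S n`, but the integrand vanishes there.
  · by_cases hy : y = 0
    · subst hy
      have h0 : ∀ n, (S n).indicator (fun y => 1 - Real.cos (inner ℝ ξ y)) 0 = 0 := fun n =>
        Set.indicator_apply_eq_zero.2 fun _ => by simp
      simp only [h0]
      simp
    · have hy' : 0 < ‖y‖ := norm_pos_iff.2 hy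
      refine tendsto_const_nhds.congr' ?_
      filter_upwards [(tendsto_one_div_add_atTop_nhds_zero_nat (𝕜 := ℝ)).eventually_lt_const hy']
        with n hn
      rw [Set.indicator_of_mem]
      simp only [hS, Set.mem_compl_iff, Metric.mem_ball, dist_zero_right, not_lt]
      exact hn.le

end LevyExponent

/-! ### The density of the semigroup and the one-jump bound. -/

section LowerBound

variable {d : ℕ} {ν : Measure (EuclideanSpace ℝ (Fin d))}

/-- The transition density of the Lévy semigroup with Lévy measure `ν`. -/
noncomputable def levyDensity (ν : Measure (EuclideanSpace ℝ (Fin d))) :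
    ℝ → EuclideanSpace ℝ (Fin d) → ℝ :=
  expDensity fun v => levyExponent ν ((2 * Real.pi) • v)

lemma norm_two_pi_smul {E : Type*} [NormedAddCommGroup E] [NormedSpace ℝ E] (v : E) :
    ‖(2 * Real.pi) • v‖ = 2 * Real.pi * ‖v‖ := by
  rw [norm_smul, Real.norm_of_nonneg Real.two_pi_pos.le]

lemma norm_le_norm_two_pi_smul {E : Type*} [NormedAddCommGroup E] [NormedSpace ℝ E] (v : E) :
    ‖v‖ ≤ ‖(2 * Real.pi) • v‖ := by
  rw [norm_two_pi_smul]
  nlinarith [norm_nonneg v, Real.pi_gt_three]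

/-- The Fourier normalization replaces $\xi$ by $2\pi v$; this only enlarges the norm, so `b`
survives. -/
lemma levyExponent_two_pi_smul_ge {b α : ℝ} (hb : 0 ≤ b) (hα : 0 ≤ α)
    (h : ∀ ξ : EuclideanSpace ℝ (Fin d), 1 < ‖ξ‖ → b * ‖ξ‖ ^ α ≤ levyExponent ν ξ)
    (v : EuclideanSpace ℝ (Fin d)) (hv : 1 < ‖v‖) :
    b * ‖v‖ ^ α ≤ levyExponent ν ((2 * Real.pi) • v) := by
  refine le_trans ?_ (h _ (hv.trans_le (norm_le_norm_two_pi_smul v)))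
  gcongr
  exact norm_le_norm_two_pi_smul v

lemma isSmoothBoundedDensity_levyDensity [Nontrivial (EuclideanSpace ℝ (Fin d))]
    (hν : IsSymmetricLevyMeasure ν) {b α : ℝ} (hb : 0 < b) (hα : 0 < α)
    (h : ∀ ξ : EuclideanSpace ℝ (Fin d), 1 < ‖ξ‖ → b * ‖ξ‖ ^ α ≤ levyExponent ν ξ)
    {P : ℝ → Measure (EuclideanSpace ℝ (Fin d))} (hP : IsLevySemigroup ν P) {t : ℝ} (ht : 0 < t) :
    IsSmoothBoundedDensity (P t) (levyDensity ν t) := by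
  have hm : Measurable fun v : EuclideanSpace ℝ (Fin d) => levyExponent ν ((2 * Real.pi) • v) :=
    ((continuous_levyExponent hν.lintegral_lt_top).comp (by fun_prop)).measurable
  have hlow := levyExponent_two_pi_smul_ge hb.le hα.le h
  have hint := integrable_ofReal_exp_neg hb hα ht hm (fun v => levyExponent_nonneg ν _) hlow
  obtain ⟨hprob, hchar⟩ := hP t ht.le
  exact
    { smooth := contDiff_expDensity hb hα ht hm (fun v => levyExponent_nonneg ν _) hlow
      nonneg := expDensity_levyExponent_nonneg hν ht.le hint
      bounded := ⟨_, expDensity_le _ t⟩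
      eq_withDensity := eq_withDensity_of_charFun_eq (P t) hint fun v => by
        rw [hchar, ← Complex.ofReal_neg, ← Complex.ofReal_exp] }

/-- Removing half of the jumps outside a ball: one large jump bounds the density from below. -/
lemma levyDensity_ge_of_jump [Nontrivial (EuclideanSpace ℝ (Fin d))]
    (hν : IsSymmetricLevyMeasure ν) {b α : ℝ} (hb : 0 < b) (hα : 0 < α)
    (h : ∀ ξ : EuclideanSpace ℝ (Fin d), 1 < ‖ξ‖ → b * ‖ξ‖ ^ α ≤ levyExponent ν ξ)
    {K κ δ : ℝ} (hκ : 0 ≤ κ)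
    (hup : ∀ r : ℝ, 0 < r → r < 1 →
      ν (Metric.ball (0 : EuclideanSpace ℝ (Fin d)) r)ᶜ ≤ ENNReal.ofReal (K * r ^ (-α)))
    {t ε : ℝ} (ht : 0 < t) (hε : 0 < ε) (hε1 : ε < 1)
    (hdiag : ∀ ρ : Measure (EuclideanSpace ℝ (Fin d)), IsSymmetricLevyMeasure ρ →
      (∀ ξ : EuclideanSpace ℝ (Fin d), 1 < ‖ξ‖ → b / 2 * ‖ξ‖ ^ α ≤ levyExponent ρ ξ) →
      ρ ≤ ν → ∀ y, ‖y‖ ≤ δ → κ ≤ levyDensity ρ t y)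
    (hεδ : ε ≤ δ) (hK : 0 ≤ K) (x : EuclideanSpace ℝ (Fin d)) (hx : 2 * ε ≤ ‖x‖) :
    κ * (Real.exp (-(t / 2 * (K * ε ^ (-α)))) * (t / 2 * (ν (Metric.ball x ε)).toReal)) ≤
      levyDensity ν t x := by
  set B : Set (EuclideanSpace ℝ (Fin d)) := Metric.ball 0 ε with hB
  have hBm : MeasurableSet B := Metric.isOpen_ball.measurableSet
  have hhalf : (1 / 2 : ENNReal) ≠ ⊤ := by simp
  have hhalf1 : (1 / 2 : ENNReal) ≤ 1 := by
    rw [one_div]; exact ENNReal.inv_le_one.2 (by norm_num)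
  have hhalfR : (1 / 2 : ENNReal).toReal = 1 / 2 := by simp
  set νo : Measure (EuclideanSpace ℝ (Fin d)) := ν.restrict Bᶜ with hνo
  -- Keeping half of the large jumps gives $\Phi_{\nu_s}\ge\frac12\Phi$ for all frequencies,
  -- whatever the radius `ε`.
  set νs : Measure (EuclideanSpace ℝ (Fin d)) := ν.restrict B + (1 / 2 : ENNReal) • νo with hνs
  have hsplit : ν = νs + (1 / 2 : ENNReal) • νo := by
    rw [hνs, add_assoc, ← add_smul, ENNReal.add_halves, one_smul, hνo,
      Measure.restrict_add_restrict_compl hBm]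
  have hνs_le : νs ≤ ν := by
    conv_rhs => rw [hsplit]
    exact Measure.le_add_right le_rfl
  have hfin_of_le : ∀ ρ : Measure (EuclideanSpace ℝ (Fin d)), ρ ≤ ν →
      ∫⁻ y, ENNReal.ofReal (min 1 (‖y‖ ^ 2)) ∂ρ < ⊤ := fun ρ hρ =>
    (lintegral_mono' hρ le_rfl).trans_lt hν.lintegral_lt_top
  have hosymm : νo.map (fun y => -y) = νo :=
    map_neg_restrict hν.symm hBm.compl (neg_preimage_compl_ball ε)
  have hνs_levy : IsSymmetricLevyMeasure νs :=
    { zero := le_antisymm ((hνs_le _).trans_eq hν.zero) zero_le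
      lintegral_lt_top := hfin_of_le _ hνs_le
      symm := by
        rw [hνs, Measure.map_add _ _ (by fun_prop), Measure.map_smul, hosymm,
          map_neg_restrict hν.symm hBm (neg_preimage_ball ε)] }
  have ho_le : νo ≤ ν := Measure.restrict_le_self
  have hsm_le : (1 / 2 : ENNReal) • νo ≤ ν := by
    conv_rhs => rw [hsplit]
    exact Measure.le_add_left le_rfl
  have hexp : ∀ ξ, levyExponent ν ξ = levyExponent νs ξ + 1 / 2 * levyExponent νo ξ := by
    intro ξ
    conv_lhs => rw [hsplit]
    rw [levyExponent_add (hfin_of_le _ hνs_le) (hfin_of_le _ hsm_le), levyExponent_smul, hhalfR]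
  have hνs_low : ∀ ξ : EuclideanSpace ℝ (Fin d), 1 < ‖ξ‖ → b / 2 * ‖ξ‖ ^ α ≤
      levyExponent νs ξ := by
    intro ξ hξ
    have h1 := h ξ hξ
    have h2 : levyExponent νs ξ = levyExponent (ν.restrict B) ξ + 1 / 2 * levyExponent νo ξ := by
      rw [hνs, levyExponent_add (hfin_of_le _ Measure.restrict_le_self) (hfin_of_le _ hsm_le),
        levyExponent_smul, hhalfR]
    have h3 := hexp ξ
    have h4 := levyExponent_nonneg (ν.restrict B) ξ
    linarith
  have hoB : νo Set.univ ≤ ENNReal.ofReal (K * ε ^ (-α)) := by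
    rw [hνo, Measure.restrict_apply_univ]; exact hup ε hε hε1
  have hofin : IsFiniteMeasure νo := ⟨hoB.trans_lt ENNReal.ofReal_lt_top⟩
  set m : Measure (EuclideanSpace ℝ (Fin d)) := ENNReal.ofReal (t / 2) • νo with hm
  have hmfin : IsFiniteMeasure m := Measure.smul_finite _ ENNReal.ofReal_ne_top
  have hmsymm : m.map (fun y => -y) = m := by rw [hm, Measure.map_smul, hosymm]
  set Q := compoundPoisson m with hQ
  have hQp : IsProbabilityMeasure Q := isProbabilityMeasure_compoundPoisson m
  have hs_m : Measurable fun v : EuclideanSpace ℝ (Fin d) => levyExponent νs ((2 * Real.pi) • v) :=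
    ((continuous_levyExponent hνs_levy.lintegral_lt_top).comp (by fun_prop)).measurable
  have hs_int := integrable_ofReal_exp_neg (half_pos hb) hα ht hs_m
    (fun v => levyExponent_nonneg νs _) (levyExponent_two_pi_smul_ge (half_pos hb).le hα.le hνs_low)
  have hs_nonneg : ∀ y, 0 ≤ levyDensity νs t y :=
    expDensity_levyExponent_nonneg hνs_levy ht.le hs_int
  have hconv : levyDensity ν t x = ∫ z, levyDensity νs t (x - z) ∂Q := by
    refine Eq.trans ?_ (fourier_mul_charFun_re hs_int Q x)
    rw [levyDensity, expDensity]
    refine congrArg (fun f : EuclideanSpace ℝ (Fin d) → ℂ => (𝓕 f x).re) (funext fun v => ?_)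
    rw [hQ, charFun_compoundPoisson_of_symm m hmsymm, hexp, hm, levyExponent_smul,
      ENNReal.toReal_ofReal (by positivity), ← Complex.ofReal_neg, ← Complex.ofReal_exp,
      ← Complex.ofReal_mul, ← Real.exp_add]
    congr 2
    ring
  have hcont : Continuous fun z => levyDensity νs t (x - z) :=
    (Complex.continuous_re.comp (continuous_fourier_of_integrable hs_int)).comp (by fun_prop)
  have hint : Integrable (fun z => levyDensity νs t (x - z)) Q := by
    refine Integrable.of_bound (C := ∫ v : EuclideanSpace ℝ (Fin d),
      Real.exp (-(t * levyExponent νs ((2 * Real.pi) • v)))) hcont.aestronglyMeasurable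
      (ae_of_all _ fun z => ?_)
    rw [Real.norm_of_nonneg (hs_nonneg _)]
    exact expDensity_le _ t _
  -- If the compound Poisson part lands at $z\in B(x,\varepsilon)$, the remaining displacement $x-z$
  -- is within the range of `hdiag`.
  have hlower : κ * Q.real (Metric.ball x ε) ≤ ∫ z, levyDensity νs t (x - z) ∂Q := by
    calc κ * Q.real (Metric.ball x ε) = ∫ _ in Metric.ball x ε, κ ∂Q := by
          rw [setIntegral_const, smul_eq_mul, mul_comm]
      _ ≤ ∫ z in Metric.ball x ε, levyDensity νs t (x - z) ∂Q := by
          refine setIntegral_mono_on (integrable_const _).integrableOn hint.integrableOn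
            Metric.isOpen_ball.measurableSet fun z hz => ?_
          refine hdiag νs hνs_levy hνs_low hνs_le _ ?_
          rw [← dist_eq_norm, dist_comm]
          exact (Metric.mem_ball.1 hz).le.trans hεδ
      _ ≤ _ := setIntegral_le_integral hint (ae_of_all _ fun z => hs_nonneg _)
  rw [hconv]
  refine le_trans ?_ hlower
  gcongr
  -- Here $\|x\|\ge2\varepsilon$ enters: every jump into the ball around `x` is a large one, so `νo`
  -- sees all of that ball.
  have hsub : Metric.ball x ε ⊆ Bᶜ := by
    intro z hz
    have h1 : ‖x - z‖ < ε := by rwa [← dist_eq_norm, dist_comm]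
    have h2 := norm_sub_norm_le x z
    simp only [hB, Set.mem_compl_iff, Metric.mem_ball, dist_zero_right, not_lt]
    linarith
  have hmball : m (Metric.ball x ε) = ENNReal.ofReal (t / 2) * ν (Metric.ball x ε) := by
    rw [hm, Measure.smul_apply, smul_eq_mul, hνo,
      Measure.restrict_apply Metric.isOpen_ball.measurableSet,
      Set.inter_eq_self_of_subset_left hsub]
  have hmuniv : m.real Set.univ ≤ t / 2 * (K * ε ^ (-α)) := by
    have h1 := ENNReal.toReal_mono ENNReal.ofReal_ne_top hoB
    rw [ENNReal.toReal_ofReal (by positivity)] at h1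
    rw [measureReal_def, hm, Measure.smul_apply, smul_eq_mul, ENNReal.toReal_mul,
      ENNReal.toReal_ofReal (by positivity)]
    gcongr
  have hQle := ENNReal.toReal_mono (measure_ne_top Q _) (le_compoundPoisson m (Metric.ball x ε))
  rw [hmball, ENNReal.toReal_mul, ENNReal.toReal_mul, ENNReal.toReal_ofReal (Real.exp_pos _).le,
    ENNReal.toReal_ofReal (by positivity)] at hQle
  refine le_trans ?_ hQle
  gcongr

lemma lowerProfile_le_left (α γ : ℝ) (q : ℝ → ℝ) (t : ℝ) (x : EuclideanSpace ℝ (Fin d)) :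
    lowerProfile α γ q t x ≤ t ^ (-(d : ℝ) / α) := by
  rw [lowerProfile]
  split_ifs
  · exact le_rfl
  · exact min_le_left _ _

lemma lowerProfile_le_right (α γ : ℝ) (q : ℝ → ℝ) (t : ℝ) {x : EuclideanSpace ℝ (Fin d)}
    (hx : x ≠ 0) :
    lowerProfile α γ q t x ≤ t ^ (1 + (γ - d) / α) * ‖x‖ ^ (-α - γ) * q ‖x‖ := by
  rw [lowerProfile, if_neg hx]
  exact min_le_right _ _

end LowerBound

end LevyDensities

/-! ### The main theorem: choice of constants and the two regimes of `x`. -/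

theorem theorem2 (d : ℕ) (hd : 1 ≤ d) (α : ℝ) (hα0 : 0 < α) (hα2 : α < 2)
    (γ : ℝ) (hγ1 : 1 ≤ γ) (hγd : γ ≤ d)
    (c c₁ c₂ : ℝ) (hc : 0 < c) (hc₁ : 0 < c₁) (hc₂ : 0 < c₂)
    (q : ℝ → ℝ) (hq_pos : ∀ s : ℝ, 0 < s → 0 < q s)
    (hq_bdd : ∃ M : ℝ, ∀ s : ℝ, 0 < s → q s ≤ M) :
    ∃ C : ℝ, 0 < C ∧
      ∀ (ν : Measure (EuclideanSpace ℝ (Fin d))) (A : Set (EuclideanSpace ℝ (Fin d)))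
        (P : ℝ → Measure (EuclideanSpace ℝ (Fin d))),
        IsSymmetricLevyMeasure ν →
        (∀ ξ : EuclideanSpace ℝ (Fin d), 1 < ‖ξ‖ → c * ‖ξ‖ ^ α ≤ levyExponent ν ξ) →
        (∀ x ∈ A, x ≠ 0 → ∀ r : ℝ, 0 < r →
          ENNReal.ofReal (c₁ * r ^ γ * ‖x‖ ^ (-α - γ) * q ‖x‖) ≤ ν (Metric.ball x r)) →
        (∀ r : ℝ, 0 < r → r < 1 →
          ν (Metric.ball (0 : EuclideanSpace ℝ (Fin d)) r)ᶜ ≤ ENNReal.ofReal (c₂ * r ^ (-α))) →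
        IsLevySemigroup ν P →
        ∃ p : ℝ → EuclideanSpace ℝ (Fin d) → ℝ,
          (∀ t : ℝ, 0 < t → IsSmoothBoundedDensity (P t) (p t)) ∧
          ∀ x ∈ A, ∀ t : ℝ, 0 < t → t < 1 → C * lowerProfile α γ q t x ≤ p t x := by
  have : Nonempty (Fin d) := ⟨⟨0, hd⟩⟩
  set K₀ : ℝ := 4 * c₂ / (2 - α) * (2 * Real.pi) ^ α with hK₀
  have h2α : 0 < 2 - α := by linarith
  have hK₀0 : 0 ≤ K₀ := by have := Real.pi_pos; positivity
  obtain ⟨κ, hκ, δ₀, hδ₀, hdiag⟩ := exists_forall_le_expDensity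
    (E := EuclideanSpace ℝ (Fin d)) (half_pos hc) hK₀0 hα0
  rw [finrank_euclideanSpace_fin] at hdiag
  -- The minimum with 1 makes $\varepsilon<1$, as the tail bound requires; the half lets the
  -- near-origin estimate reach radius $2\varepsilon$.
  set δ : ℝ := min δ₀ 1 / 2 with hδ
  have hδpos : 0 < δ := by positivity
  have hδ1 : δ < 1 := by have := min_le_right δ₀ 1; rw [hδ]; linarith
  have hδδ₀ : 2 * δ ≤ δ₀ := by have := min_le_left δ₀ 1; rw [hδ]; linarith
  set C₁ : ℝ := κ * (Real.exp (-(c₂ / 2 * δ ^ (-α))) * (c₁ / 2 * δ ^ γ)) with hC₁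
  have hC₁pos : 0 < C₁ := by positivity
  refine ⟨min κ C₁, lt_min hκ hC₁pos, ?_⟩
  intro ν A P hν hlow hball htail hP
  refine ⟨levyDensity ν, fun t ht => isSmoothBoundedDensity_levyDensity hν hc hα0 hlow hP ht, ?_⟩
  intro x hxA t ht ht1
  have htpos : 0 < t ^ (1 / α) := Real.rpow_pos_of_pos ht _
  have hlp : 0 ≤ lowerProfile α γ q t x := by
    rw [lowerProfile]
    split_ifs with h0
    · positivity
    · have := hq_pos ‖x‖ (norm_pos_iff.2 h0)
      positivity
  -- Stated for every $\rho\le\nu$ with lower constant `c / 2`, so that it serves both `ν` itself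
  -- and the reduced measure of `levyDensity_ge_of_jump`.
  have hnear : ∀ ρ : Measure (EuclideanSpace ℝ (Fin d)), IsSymmetricLevyMeasure ρ →
      (∀ ξ : EuclideanSpace ℝ (Fin d), 1 < ‖ξ‖ → c / 2 * ‖ξ‖ ^ α ≤ levyExponent ρ ξ) →
      ρ ≤ ν → ∀ y, ‖y‖ ≤ δ₀ * t ^ (1 / α) → κ * t ^ (-(d : ℝ) / α) ≤ levyDensity ρ t y := by
    intro ρ hρ hρlow hρν y hy
    refine hdiag _ ((continuous_levyExponent hρ.lintegral_lt_top).comp (by fun_prop)).measurable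
      (fun v => levyExponent_nonneg ρ _)
      (levyExponent_two_pi_smul_ge (half_pos hc).le hα0.le hρlow) (fun v hv => ?_) t ht ht1 y hy
    have h1 := levyExponent_le_mul_rpow hα2 hc₂.le
      (fun r hr hr1 => (hρν _).trans (htail r hr hr1)) ((2 * Real.pi) • v)
      (hv.trans (norm_le_norm_two_pi_smul v))
    rw [norm_two_pi_smul, Real.mul_rpow Real.two_pi_pos.le (norm_nonneg _), ← mul_assoc] at h1
    exact h1
  have hlow' : ∀ ξ : EuclideanSpace ℝ (Fin d), 1 < ‖ξ‖ → c / 2 * ‖ξ‖ ^ α ≤ levyExponent ν ξ := by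
    intro ξ hξ
    have h1 := hlow ξ hξ
    have h2 : 0 ≤ c * ‖ξ‖ ^ α := by positivity
    linarith
  set ε : ℝ := δ * t ^ (1 / α) with hε
  have hεpos : 0 < ε := by positivity
  have ht1' : t ^ (1 / α) ≤ 1 := Real.rpow_le_one ht.le ht1.le (by positivity)
  have hε1 : ε < 1 := by nlinarith
  have h2ε : 2 * ε ≤ δ₀ * t ^ (1 / α) := by rw [hε]; nlinarith
  by_cases hx : ‖x‖ < 2 * ε
  · calc min κ C₁ * lowerProfile α γ q t x ≤ κ * t ^ (-(d : ℝ) / α) := by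
          gcongr
          · exact min_le_left _ _
          · exact lowerProfile_le_left α γ q t x
      _ ≤ levyDensity ν t x := hnear ν hν hlow' le_rfl x (hx.le.trans h2ε)
  · rw [not_lt] at hx
    have hx0 : x ≠ 0 := norm_pos_iff.1 (by linarith)
    have hqx := hq_pos ‖x‖ (norm_pos_iff.2 hx0)
    have hjump := levyDensity_ge_of_jump hν hc hα0 hlow
      (by positivity : 0 ≤ κ * t ^ (-(d : ℝ) / α)) htail ht hεpos hε1 hnear
      (by linarith) hc₂.le x hx
    -- This choice of scale keeps the exponential weight in the one-jump bound independent of `t`.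
    have hεα : t * ε ^ (-α) = δ ^ (-α) := by
      rw [hε, Real.mul_rpow hδpos.le htpos.le, ← Real.rpow_mul ht.le, mul_neg,
        one_div_mul_cancel hα0.ne', Real.rpow_neg_one]
      field_simp
    have hεγ : ε ^ γ = δ ^ γ * t ^ (γ / α) := by
      rw [hε, Real.mul_rpow hδpos.le htpos.le, ← Real.rpow_mul ht.le, one_div_mul_eq_div]
    have htexp : t ^ (1 + (γ - d) / α) = t ^ (-(d : ℝ) / α) * (t * t ^ (γ / α)) := by
      rw [← Real.rpow_one_add' ht.le (by positivity), ← Real.rpow_add ht]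
      congr 1; ring
    have hballx : c₁ * ε ^ γ * ‖x‖ ^ (-α - γ) * q ‖x‖ ≤ (ν (Metric.ball x ε)).toReal := by
      refine (ENNReal.ofReal_le_iff_le_toReal ?_).1 (hball x hxA hx0 ε hεpos)
      refine ((measure_mono ?_).trans_lt
        (measure_compl_ball_lt_top hν.lintegral_lt_top hεpos)).ne
      intro z hz
      have h1 : ‖x - z‖ < ε := by rwa [← dist_eq_norm, dist_comm]
      have h2 := norm_sub_norm_le x z
      simp only [Set.mem_compl_iff, Metric.mem_ball, dist_zero_right, not_lt]
      linarith
    calc min κ C₁ * lowerProfile α γ q t x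
        ≤ C₁ * (t ^ (1 + (γ - d) / α) * ‖x‖ ^ (-α - γ) * q ‖x‖) := by
          gcongr
          · exact min_le_right _ _
          · exact lowerProfile_le_right α γ q t hx0
      _ = κ * t ^ (-(d : ℝ) / α) * (Real.exp (-(t / 2 * (c₂ * ε ^ (-α)))) *
            (t / 2 * (c₁ * ε ^ γ * ‖x‖ ^ (-α - γ) * q ‖x‖))) := by
          have h1 : t / 2 * (c₂ * ε ^ (-α)) = c₂ / 2 * δ ^ (-α) := by
            linear_combination (c₂ / 2) * hεα
          rw [h1, hC₁, htexp, hεγ]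
          ring
      _ ≤ _ := by gcongr
      _ ≤ levyDensity ν t x := hjump
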